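/- Let $\mathcal H$ be a real Hilbert space, $\mathcal G$ a real normed space, $0\le m\le n$ integers, $I=\{1,\dots,m\}$ and $I_0=\{m+1,\dots,n\}$ (each possibly empty). Let $h_i:\mathcal G\times\mathcal H\to\mathbb R$, $i=1,\dots,n$, be jointly continuous functions that are differentiable in $x$ and whose partial gradients $\nabla_x h_i:\mathcal G\times\mathcal H\to\mathcal H$ are jointly continuous. Put $$F(p)=\{x\in\mathcal H : h_i(p,x)\le 0\ (i\in I),\ h_i(p,x)=0\ (i\in I_0)\},\qquad \operatorname{dom}F=\{p\in\mathcal G : F(p)\neq\emptyset\},$$ and let $(p^0,x^0)$ satisfy $x^0\in F(p^0)$. Assume: 1. ($F$ is lower semicontinuous at $(p^0,x^0)$ relative to $\operatorname{dom}F$.) For every neighbourhood $W$ of $x^0$ there is a neighbourhood $V$ of $p^0$ such that $F(p)\cap W\neq\emptyset$ for all $p\in V\cap\operatorname{dom}F$. 2. ($F$ satisfies the relaxed constant rank constraint qualification (RCRCQ) at $(p^0,x^0)$ relative to $\operatorname{dom}F\times\mathcal H$.) For every $K\subseteq I(p^0,x^0):=\{i\in I : h_i(p^0,x^0)=0\}$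 there is a neighbourhood $U$ of $(p^0,x^0)$ such that for all $(p,x)\in U$ with $p\in\operatorname{dom}F$, $$\operatorname{rank}\{\nabla_x h_i(p,x) : i\in I_0\cup K\}=\operatorname{rank}\{\nabla_x h_i(p^0,x^0) : i\in I_0\cup K\}.$$ Then $F$ is R-regular at $(p^0,x^0)$ relative to $\operatorname{dom}F$: there exist a number $M>0$ and neighbourhoods $V(p^0)$ of $p^0$ and $V(x^0)$ of $x^0$ such that $$\operatorname{dist}(x,F(p))\le M\max\{0,\ h_i(p,x)\ (i\in I),\ |h_i(p,x)|\ (i\in I_0)\}$$ for all $x\in V(x^0)$ and all $p\in V(p^0)\cap\operatorname{dom}F$. -/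

import Mathlib

open Topology

noncomputable section

/-- The indices of the inequality constraints: the first `m` of the `n` indices. -/
def ineqIdx (m n : ℕ) : Set (Fin n) := {i | (i : ℕ) < m}

/-- The indices of the equality constraints: the remaining `n - m` indices. -/
def eqIdx (m n : ℕ) : Set (Fin n) := {i | m ≤ (i : ℕ)}

/-- The feasible set mapping `F(p) = {x | hᵢ(p,x) ≤ 0 (i ∈ I), hᵢ(p,x) = 0 (i ∈ I₀)}`. -/
def feasibleMap {G H : Type*} (m : ℕ) {n : ℕ} (h : Fin n → G → H → ℝ) (p : G) : Set H :=
  {x | (∀ i ∈ ineqIdx m n, h i p x ≤ 0) ∧ (∀ i ∈ eqIdx m n, h i p x = 0)}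

/-- The domain of a set-valued mapping. -/
def setValuedDom {G H : Type*} (F : G → Set H) : Set G := {p | (F p).Nonempty}

/-- The graph of a set-valued mapping. -/
def setValuedGraph {G H : Type*} (F : G → Set H) : Set (G × H) := {z | z.2 ∈ F z.1}

/-- Lower semicontinuity of a set-valued mapping at `(p₀, x₀)` relative to `P`. -/
def LscAtRel {G H : Type*} [TopologicalSpace G] [TopologicalSpace H]
    (F : G → Set H) (P : Set G) (p₀ : G) (x₀ : H) : Prop :=
  ∀ W ∈ 𝓝 x₀, ∃ V ∈ 𝓝 p₀, ∀ p ∈ V ∩ P, (F p ∩ W).Nonempty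

/-- The active inequality constraints at `(p, x)`. -/
def activeIdx {G H : Type*} (m : ℕ) {n : ℕ} (h : Fin n → G → H → ℝ) (p : G) (x : H) :
    Set (Fin n) :=
  {i | i ∈ ineqIdx m n ∧ h i p x = 0}

/-- The rank of the family of partial gradients `∇ₓ hᵢ(p,x)`, `i ∈ J`. -/
def gradRank {G H : Type*} [NormedAddCommGroup H] [InnerProductSpace ℝ H] [CompleteSpace H]
    {n : ℕ} (h : Fin n → G → H → ℝ) (J : Set (Fin n)) (p : G) (x : H) : ℕ :=
  Module.finrank ℝ (Submodule.span ℝ ((fun i => gradient (h i p) x) '' J))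

/-- The relaxed constant rank constraint qualification at `(p₀, x₀)` relative to `P × X`. -/
def RCRCQ {G H : Type*} [TopologicalSpace G] [NormedAddCommGroup H] [InnerProductSpace ℝ H]
    [CompleteSpace H] (m : ℕ) {n : ℕ} (h : Fin n → G → H → ℝ) (P : Set G) (X : Set H)
    (p₀ : G) (x₀ : H) : Prop :=
  ∀ K ⊆ activeIdx m h p₀ x₀, ∃ U ∈ 𝓝 (p₀, x₀), ∀ z ∈ U ∩ P ×ˢ X,
    gradRank h (eqIdx m n ∪ K) z.1 z.2 = gradRank h (eqIdx m n ∪ K) p₀ x₀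

/-- The residual `max {0, hᵢ(p,x) (i ∈ I), |hᵢ(p,x)| (i ∈ I₀)}`. The suprema are over finite
families, and a supremum over an empty family of reals is `0`. -/
def constraintResidual {G H : Type*} (m : ℕ) {n : ℕ} (h : Fin n → G → H → ℝ) (p : G) (x : H) : ℝ :=
  max 0 (max (⨆ i : ineqIdx m n, h i p x) (⨆ i : eqIdx m n, |h i p x|))

/-- R-regularity of the feasible set mapping at `(p₀, x₀)` relative to `P`. The distance is
`Metric.infEDist`, so that the distance to an empty set is infinite. -/
def RRegular {G H : Type*} [TopologicalSpace G] [PseudoEMetricSpace H] (m : ℕ) {n : ℕ}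
    (h : Fin n → G → H → ℝ) (P : Set G) (p₀ : G) (x₀ : H) : Prop :=
  ∃ M : ℝ, 0 < M ∧ ∃ V ∈ 𝓝 p₀, ∃ W ∈ 𝓝 x₀, ∀ x ∈ W, ∀ p ∈ V ∩ P,
    Metric.infEDist x (feasibleMap m h p) ≤ ENNReal.ofReal (M * constraintResidual m h p x)

end

/-!
Write `gᵢ = ∇ₓhᵢ`. For `p ∈ dom F` near `p₀` and an infeasible `x` near `x₀`, the distance from `x` to
`F(p)` is controlled by first-order multipliers at an almost nearest feasible point, and the rank
condition bounds these multipliers uniformly in `(p, x)`.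

Nearest points of `F(p)` need not exist in an infinite-dimensional space, so the distance to `x` is
minimised only approximately: the variational principle `exists_forall_le_add_mul_dist` gives
`y ∈ F(p)` such that `‖x - y‖ ≤ ‖x - z‖ + ε‖y - z‖` for every `z ∈ F(p)`. Lower semicontinuity supplies
a starting point of `F(p)` near `x₀`, which keeps `y` near `x₀`.

At `y` the rank condition is a constraint qualification for the fixed parameter `p`: if `d` is
orthogonal to the gradients `gᵢ(p, y)`, `i ∈ J`, and the rank of the gradients in `J` is constant near
`y`, then `d` is the velocity of a curve on which all `hᵢ(p, ·)`, `i ∈ J`, are constant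
(`exists_curve_hasDerivAt_of_finrank_eq`). The curve comes from the implicit function theorem applied
to a maximal independent subfamily `B ⊆ J`; the remaining functions stay constant along it because
their gradients remain in the span of those of `B`. Hence every `d` in the linearised cone is tangent
to `F(p)`, so the unit vector `u` from `y` to `x` satisfies `⟪u, d⟫ ≤ ε‖d‖` there, and by
projection onto the closure of the cone of the combinations `∑ μᵢ gᵢ(p, y)` over equality and active
inequality constraints with `μᵢ ≥ 0` for inequalities, whose polar is the linearised cone, `u` is
within `2ε` of such a combination `v` (`exists_multiplier_of_le_norm_add`).

By a Carathéodory reduction (`exists_linearIndepOn_multiplierCone`) the combination may be taken over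
`B ∪ K`, independent at `(p, y)`, where `B` indexes a fixed basis of the equality gradients at
`(p₀, x₀)`. Equality of the ranks of `I₀ ∪ K` at `(p, y)` and `(p₀, x₀)` makes `B ∪ K` independent at
`(p₀, x₀)` as well; there are finitely many such families, so `∑ |μᵢ| ≤ c‖v‖` with `c` independent of
`(p, y)` (`eventually_uniform_multiplier_bound`). Pairing `u` with `x - y` and using
`hᵢ(p, x) ≈ ⟪gᵢ(p, y), x - y⟫`, uniformly near `(p₀, x₀)`, bounds `‖x - y‖` by a multiple of the
residual plus a term absorbed on the left.
-/

/-! ### An approximate variational principle -/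

/-- A weak form of Ekeland's variational principle: a nonnegative continuous function on a complete
space, perturbed by a multiple of the distance to a suitable point, is minimal at that point. -/
theorem exists_forall_le_add_mul_dist {X : Type*} [MetricSpace X] [CompleteSpace X]
    {f : X → ℝ} (hf : Continuous f) (hf0 : ∀ x, 0 ≤ f x) {ε : ℝ} (hε : 0 < ε) (x₀ : X) :
    ∃ y, f y ≤ f x₀ ∧ ∀ z, f y ≤ f z + ε * dist y z := by
  -- `z ∈ S x` is a transitive relation; `y` is the limit of a chain that almost minimises `f` on
  -- each successive `S x`.
  let S : X → Set X := fun x => {z | f z + ε * dist x z ≤ f x}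
  have hself : ∀ x, x ∈ S x := fun x => by simp [S]
  have htrans : ∀ x y z, y ∈ S x → z ∈ S y → z ∈ S x := by
    intro x y z hy hz
    simp only [S, Set.mem_ofPred_eq] at hy hz ⊢
    nlinarith [dist_triangle x y z]
  have hclosed : ∀ x, IsClosed (S x) := fun x =>
    isClosed_le (by fun_prop) continuous_const
  have hbdd : ∀ x, BddBelow (f '' S x) := fun x => ⟨0, by rintro _ ⟨z, -, rfl⟩; exact hf0 z⟩
  have hstep : ∀ (k : ℕ) (x : X), ∃ y ∈ S x, ∀ z ∈ S x, f y ≤ f z + (1 / 2 : ℝ) ^ k := by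
    intro k x
    have hlt : sInf (f '' S x) < sInf (f '' S x) + (1 / 2 : ℝ) ^ k := by
      have : (0 : ℝ) < (1 / 2) ^ k := by positivity
      linarith
    obtain ⟨_, ⟨y, hy, rfl⟩, hlt'⟩ := exists_lt_of_csInf_lt (Set.Nonempty.image f ⟨x, hself x⟩) hlt
    refine ⟨y, hy, fun z hz => ?_⟩
    have := csInf_le (hbdd x) ⟨z, hz, rfl⟩
    linarith
  choose s hsS hsmin using hstep
  let u : ℕ → X := fun k => Nat.rec x₀ (fun k x => s k x) k
  have hu : ∀ k, u (k + 1) = s k (u k) := fun k => rfl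
  have hmem : ∀ k j, k ≤ j → u j ∈ S (u k) := by
    intro k j hkj
    induction j, hkj using Nat.le_induction with
    | base => exact hself _
    | succ j _ ih => exact htrans _ _ _ ih (by rw [hu]; exact hsS j (u j))
  have hanti : Antitone (fun k => f (u k)) := by
    intro k j hkj
    have := hmem k j hkj
    simp only [S, Set.mem_ofPred_eq] at this
    nlinarith [dist_nonneg (x := u k) (y := u j)]
  have hlim := tendsto_atTop_ciInf hanti ⟨0, by rintro _ ⟨k, rfl⟩; exact hf0 _⟩
  have hcauchy : CauchySeq u := by
    have hc := hlim.cauchySeq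
    rw [Metric.cauchySeq_iff'] at hc ⊢
    intro δ hδ
    obtain ⟨N, hN⟩ := hc (ε * δ) (by positivity)
    refine ⟨N, fun j hj => ?_⟩
    have h1 := hmem N j hj
    have h2 := hN j hj
    simp only [S, Set.mem_ofPred_eq] at h1
    rw [Real.dist_eq, abs_lt] at h2
    rw [dist_comm]
    have : ε * dist (u N) (u j) < ε * δ := by linarith
    exact lt_of_mul_lt_mul_left this hε.le
  obtain ⟨y, hy⟩ := cauchySeq_tendsto_of_complete hcauchy
  have hyS : ∀ k, y ∈ S (u k) := fun k =>
    (hclosed _).mem_of_tendsto hy (Filter.eventually_atTop.2 ⟨k, fun j hj => hmem k j hj⟩)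
  have hle : ∀ k, f y ≤ f (u k) := fun k => by
    have := hyS k
    simp only [S, Set.mem_ofPred_eq] at this
    nlinarith [dist_nonneg (x := u k) (y := y)]
  refine ⟨y, hle 0, fun z => ?_⟩
  by_contra! hlt
  have hz : z ∈ S y := by simpa [S] using hlt.le
  have hyz : f y ≤ f z := by
    refine le_of_tendsto_of_tendsto' (b := Filter.atTop) (f := fun _ : ℕ => f y)
      (g := fun k : ℕ => f z + (1 / 2 : ℝ) ^ k) tendsto_const_nhds ?_ fun k => ?_
    · simpa using tendsto_const_nhds.add
        (tendsto_pow_atTop_nhds_zero_of_lt_one (r := (1 / 2 : ℝ)) (by norm_num) (by norm_num))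
    · exact (hle (k + 1)).trans (by rw [hu]; exact hsmin k (u k) z (htrans _ _ _ (hyS k) hz))
  nlinarith [dist_nonneg (x := y) (y := z)]

/-! ### Approximate polarity and conic combinations -/

section Cone

variable {H : Type*} [NormedAddCommGroup H] [InnerProductSpace ℝ H]

/-- An approximate bipolar theorem: a vector that is almost nonpositive on the polar of `C` is close
to `C`. The cone `C` need not be closed, which costs the factor `2`. -/
theorem PointedCone.exists_norm_sub_le_of_inner_le [CompleteSpace H] (C : PointedCone ℝ H) {u : H}
    {ε : ℝ} (hε : 0 < ε)
    (hu : ∀ w : H, (∀ c ∈ C, inner ℝ c w ≤ 0) → inner ℝ u w ≤ ε * ‖w‖) :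
    ∃ v ∈ C, ‖u - v‖ ≤ 2 * ε := by
  set D : Set H := closure (C : Set H)
  have hCD : (C : Set H) ⊆ D := subset_closure
  have h0 : (0 : H) ∈ D := hCD C.zero_mem
  have hadd : ∀ a ∈ D, ∀ c ∈ C, a + c ∈ D := fun a ha c hc =>
    map_mem_closure (f := fun x => x + c) (by fun_prop) ha fun x hx => C.add_mem hx hc
  have hconv : Convex ℝ D := (PointedCone.convex C).closure
  obtain ⟨a, ha, hmin⟩ := exists_norm_eq_iInf_of_complete_convex ⟨0, h0⟩
    isClosed_closure.isComplete hconv u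
  rw [norm_eq_iInf_iff_real_inner_le_zero hconv ha] at hmin
  -- The residual `u - a` of the projection `a` of `u` lies in the polar of `C`.
  have h1 : inner ℝ u (u - a) ≤ ε * ‖u - a‖ := by
    refine hu _ fun c hc => ?_
    have := hmin _ (hadd a ha c hc)
    rwa [add_sub_cancel_left, real_inner_comm] at this
  have h2 : 0 ≤ inner ℝ (u - a) a := by
    have := hmin 0 h0
    rw [zero_sub, inner_neg_right] at this
    linarith
  have h3 : ‖u - a‖ ≤ ε := by
    have h4 : ‖u - a‖ * ‖u - a‖ ≤ ε * ‖u - a‖ := by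
      rw [← real_inner_self_eq_norm_mul_norm]
      have : inner ℝ (u - a) (u - a) = inner ℝ u (u - a) - inner ℝ (u - a) a := by
        rw [inner_sub_right, real_inner_comm u (u - a)]
      linarith
    rcases (norm_nonneg (u - a)).eq_or_lt with h | h
    · rw [← h]; exact hε.le
    · exact le_of_mul_le_mul_right h4 h
  obtain ⟨v, hv, hav⟩ := Metric.mem_closure_iff.1 ha ε hε
  refine ⟨v, hv, ?_⟩
  rw [dist_eq_norm] at hav
  calc ‖u - v‖ ≤ ‖u - a‖ + ‖a - v‖ := norm_sub_le_norm_sub_add_norm_sub u a v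
    _ ≤ 2 * ε := by linarith

end Cone

section Combination

variable {ι H : Type*} [AddCommGroup H] [Module ℝ H]

/-- The cone of combinations `∑ i ∈ S, μ i • g i` whose coefficients are nonnegative on `A`
and of arbitrary sign on the rest of `S`. -/
def multiplierCone (g : ι → H) (S A : Finset ι) : PointedCone ℝ H where
  carrier := {v | ∃ μ : ι → ℝ, (∀ i ∈ A, 0 ≤ μ i) ∧ ∑ i ∈ S, μ i • g i = v}
  zero_mem' := ⟨0, by simp, by simp⟩
  add_mem' := by
    rintro _ _ ⟨μ, hμ, rfl⟩ ⟨ν, hν, rfl⟩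
    exact ⟨μ + ν, fun i hi => add_nonneg (hμ i hi) (hν i hi),
      by simp [add_smul, Finset.sum_add_distrib]⟩
  smul_mem' := by
    rintro ⟨c, hc⟩ _ ⟨μ, hμ, rfl⟩
    exact ⟨c • μ, fun i hi => mul_nonneg hc (hμ i hi), by
      simp [Finset.smul_sum, smul_smul, Nonneg.mk_smul]⟩

theorem mem_multiplierCone {g : ι → H} {S A : Finset ι} {v : H} :
    v ∈ multiplierCone g S A ↔
      ∃ μ : ι → ℝ, (∀ i ∈ A, 0 ≤ μ i) ∧ ∑ i ∈ S, μ i • g i = v := Iff.rfl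

/-- Carathéodory's theorem for cones, relative to an independent family `B` of generators whose
coefficients carry no sign: `B` is kept and only generators from `A` are discarded. -/
theorem exists_linearIndepOn_multiplierCone [DecidableEq ι] {g : ι → H} {B A : Finset ι}
    (hBA : Disjoint B A) (hB : LinearIndepOn ℝ g (B : Set ι)) {v : H}
    (hv : v ∈ multiplierCone g (B ∪ A) A) :
    ∃ K ⊆ A, LinearIndepOn ℝ g ((B ∪ K : Finset ι) : Set ι) ∧
      v ∈ multiplierCone g (B ∪ K) K := by
  induction hn : A.card using Nat.strong_induction_on generalizing A with
  | _ n ih =>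
  by_cases hind : LinearIndepOn ℝ g ((B ∪ A : Finset ι) : Set ι)
  · exact ⟨A, subset_rfl, hind, hv⟩
  obtain ⟨μ, hμ, hsum⟩ := hv
  -- `B` is independent, so a dependence relation involves some index of `A`; up to a sign its
  -- coefficient there is positive.
  obtain ⟨a, ha, hpos⟩ : ∃ a : ι → ℝ, ∑ i ∈ B ∪ A, a i • g i = 0 ∧ ∃ i ∈ A, 0 < a i := by
    rw [linearIndepOn_finset_iff] at hind
    push Not at hind
    obtain ⟨a, ha, i, hi, hai⟩ := hind
    obtain ⟨k, hk, hak⟩ : ∃ k ∈ A, a k ≠ 0 := by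
      by_contra! hzero
      rw [Finset.sum_union hBA, Finset.sum_eq_zero (s := A) fun k hk => by simp [hzero k hk],
        add_zero] at ha
      rcases Finset.mem_union.1 hi with hiB | hiA
      · exact hai (linearIndepOn_finset_iff.1 hB a ha i hiB)
      · exact hai (hzero i hiA)
    rcases hak.lt_or_gt with h | h
    · exact ⟨-a, by simp [ha], k, hk, by simpa using h⟩
    · exact ⟨a, ha, k, hk, h⟩
  -- Subtracting the largest multiple of the relation that preserves the signs kills one coefficient.
  obtain ⟨k, hk, hmin⟩ := (A.filter fun i => 0 < a i).exists_min_image (fun i => μ i / a i)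
    (by obtain ⟨i, hi, h⟩ := hpos; exact ⟨i, by simp [hi, h]⟩)
  simp only [Finset.mem_filter] at hk hmin
  obtain ⟨hkA, hak⟩ := hk
  set t := μ k / a k with ht
  have ht0 : 0 ≤ t := div_nonneg (hμ k hkA) hak.le
  have hk0 : μ k - t * a k = 0 := by rw [ht]; field_simp; ring
  have hkB : k ∉ B := fun h => Finset.disjoint_left.1 hBA h hkA
  have hnew : v ∈ multiplierCone g (B ∪ A.erase k) (A.erase k) := by
    refine ⟨fun i => μ i - t * a i, fun i hi => ?_, ?_⟩
    · have hiA := Finset.mem_of_mem_erase hi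
      rcases le_or_gt (a i) 0 with h | h
      · nlinarith [hμ i hiA]
      · have := hmin i ⟨hiA, h⟩
        rw [le_div_iff₀ h] at this
        linarith
    · have : B ∪ A.erase k = (B ∪ A).erase k := by
        rw [Finset.erase_union_distrib, Finset.erase_eq_of_notMem hkB]
      rw [this, Finset.sum_erase _ (by simp only [hk0, zero_smul])]
      simp only [sub_smul, Finset.sum_sub_distrib, mul_smul, ← Finset.smul_sum, ha, hsum]
      simp
  obtain ⟨K, hK, h1, h2⟩ := ih _ (by rw [← hn]; exact Finset.card_erase_lt_of_mem hkA)
    (hBA.mono_right (Finset.erase_subset k A)) hnew rfl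
  exact ⟨K, hK.trans (Finset.erase_subset k A), h1, h2⟩

end Combination

/-! ### Ranks and uniform independence -/

section Rank

variable {ι H : Type*} [AddCommGroup H] [Module ℝ H]

theorem exists_linearIndepOn_span_image_eq (g : ι → H) (J : Finset ι) :
    ∃ B ⊆ J, LinearIndepOn ℝ g (B : Set ι) ∧
      Submodule.span ℝ (g '' B) = Submodule.span ℝ (g '' J) := by
  have h0 := linearIndepOn_empty ℝ g
  have hsub : (∅ : Set ι) ⊆ J := Set.empty_subset _
  have hfin : (h0.extend hsub).Finite := J.finite_toSet.subset (h0.extend_subset hsub)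
  refine ⟨hfin.toFinset, ?_, ?_, ?_⟩
  · intro i hi
    exact_mod_cast h0.extend_subset hsub (hfin.mem_toFinset.1 hi)
  · rw [hfin.coe_toFinset]
    exact h0.linearIndepOn_extend hsub
  · rw [hfin.coe_toFinset]
    exact h0.span_image_extend_eq_span_image hsub

theorem linearIndepOn_iff_finrank_span_image {g : ι → H} {B : Finset ι} :
    LinearIndepOn ℝ g (B : Set ι) ↔ Module.finrank ℝ (Submodule.span ℝ (g '' B)) = B.card := by
  rw [LinearIndepOn, linearIndependent_iff_card_eq_finrank_span, Set.finrank, Set.image_eq_range]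
  simp [eq_comm]

theorem span_image_eq_of_finrank_eq_card {g : ι → H} {B J : Finset ι} (hBJ : B ⊆ J)
    (hB : LinearIndepOn ℝ g (B : Set ι))
    (hJ : Module.finrank ℝ (Submodule.span ℝ (g '' J)) = B.card) :
    Submodule.span ℝ (g '' B) = Submodule.span ℝ (g '' J) := by
  have : FiniteDimensional ℝ (Submodule.span ℝ (g '' J)) :=
    FiniteDimensional.span_of_finite ℝ (J.finite_toSet.image g)
  refine Submodule.eq_of_le_of_finrank_eq
    (Submodule.span_mono (Set.image_mono (by exact_mod_cast hBJ))) ?_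
  rw [hJ, linearIndepOn_iff_finrank_span_image.1 hB]

end Rank

/-- Linear independence of a finite family is stable under perturbation, with a bound on the
coefficients of combinations that is uniform over a neighbourhood. -/
theorem LinearIndepOn.eventually_sum_abs_le {ι H Z : Type*} [NormedAddCommGroup H]
    [NormedSpace ℝ H] [TopologicalSpace Z] {g : ι → Z → H} {z₀ : Z} {S : Finset ι}
    (hS : LinearIndepOn ℝ (fun i => g i z₀) (S : Set ι))
    (hg : ∀ i ∈ S, ContinuousAt (g i) z₀) :
    ∃ c : ℝ, 0 < c ∧ ∀ᶠ z in 𝓝 z₀, ∀ μ : ι → ℝ, ∑ i ∈ S, |μ i| ≤ c * ‖∑ i ∈ S, μ i • g i z‖ := by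
  let T : (S → ℝ) →ₗ[ℝ] H := Fintype.linearCombination ℝ (fun i : S => g i z₀)
  have hT : Function.Injective T := by
    rw [← LinearMap.ker_eq_bot, LinearMap.ker_eq_bot']
    intro μ hμ
    ext i
    exact Fintype.linearIndependent_iff.1 hS μ (by simpa [T, Fintype.linearCombination_apply]
      using hμ) i
  obtain ⟨k, hk, hanti⟩ := T.injective_iff_antilipschitz.1 hT
  have hbound : ∀ μ : ι → ℝ, ∑ i ∈ S, |μ i| ≤ S.card * k * ‖∑ i ∈ S, μ i • g i z₀‖ := by
    intro μ
    have h1 := hanti.le_mul_dist (fun i : S => μ i) 0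
    rw [dist_zero_right, map_zero, dist_zero_right] at h1
    have h2 : T (fun i : S => μ i) = ∑ i ∈ S, μ i • g i z₀ := by
      simp only [T, Fintype.linearCombination_apply]
      exact Finset.sum_coe_sort S fun i => μ i • g i z₀
    rw [h2] at h1
    calc ∑ i ∈ S, |μ i| ≤ ∑ i ∈ S, k * ‖∑ i ∈ S, μ i • g i z₀‖ :=
          Finset.sum_le_sum fun i hi => (norm_le_pi_norm (fun i : S => μ i) ⟨i, hi⟩).trans h1
      _ = _ := by rw [Finset.sum_const, nsmul_eq_mul, mul_assoc]
  set c : ℝ := S.card * k + 1 with hc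
  have hc0 : 0 < c := by positivity
  refine ⟨2 * c, by positivity, ?_⟩
  have hnear : ∀ᶠ z in 𝓝 z₀, ∀ i ∈ S, ‖g i z - g i z₀‖ < 1 / (2 * c) := by
    rw [Filter.eventually_all_finset]
    intro i hi
    have := (hg i hi).eventually (Metric.ball_mem_nhds (g i z₀) (ε := 1 / (2 * c)) (by positivity))
    filter_upwards [this] with z hz
    rwa [dist_eq_norm] at hz
  filter_upwards [hnear] with z hz μ
  have h1 : ‖∑ i ∈ S, μ i • g i z₀‖
      ≤ ‖∑ i ∈ S, μ i • g i z‖ + (∑ i ∈ S, |μ i|) * (1 / (2 * c)) := by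
    have h2 : ‖∑ i ∈ S, μ i • (g i z - g i z₀)‖ ≤ (∑ i ∈ S, |μ i|) * (1 / (2 * c)) := by
      rw [Finset.sum_mul]
      refine norm_sum_le_of_le _ fun i hi => ?_
      rw [norm_smul, Real.norm_eq_abs]
      exact mul_le_mul_of_nonneg_left (hz i hi).le (abs_nonneg _)
    have h3 : ∑ i ∈ S, μ i • g i z₀
        = ∑ i ∈ S, μ i • g i z - ∑ i ∈ S, μ i • (g i z - g i z₀) := by
      simp [smul_sub, Finset.sum_sub_distrib]
    rw [h3]
    exact (norm_sub_le _ _).trans (by linarith)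
  have h4 : ∑ i ∈ S, |μ i| ≤ c * ‖∑ i ∈ S, μ i • g i z₀‖ :=
    (hbound μ).trans (mul_le_mul_of_nonneg_right (by linarith) (norm_nonneg _))
  have h5 := mul_le_mul_of_nonneg_left h1 hc0.le
  have h6 : c * ((∑ i ∈ S, |μ i|) * (1 / (2 * c))) = (∑ i ∈ S, |μ i|) / 2 := by field_simp
  rw [mul_add, h6] at h5
  linarith

theorem linearIndepOn_of_sum_abs_le {ι H : Type*} [NormedAddCommGroup H]
    [NormedSpace ℝ H] {g : ι → H} {S : Finset ι} {c : ℝ}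
    (h : ∀ μ : ι → ℝ, ∑ i ∈ S, |μ i| ≤ c * ‖∑ i ∈ S, μ i • g i‖) :
    LinearIndepOn ℝ g (S : Set ι) := by
  rw [linearIndepOn_finset_iff]
  intro μ hμ i hi
  have h1 := h μ
  rw [hμ, norm_zero, mul_zero] at h1
  have h2 := Finset.single_le_sum (f := fun i => |μ i|) (fun j _ => abs_nonneg (μ j)) hi
  exact abs_nonpos_iff.1 (h2.trans h1)

/-! ### Curves in level sets of constant rank -/

section Curve

variable {ι H : Type*} [NormedAddCommGroup H] [InnerProductSpace ℝ H] [CompleteSpace H]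

theorem contDiff_one_of_hasGradientAt {f : H → ℝ} {g : H → H}
    (hf : ∀ x, HasGradientAt f (g x) x) (hg : Continuous g) : ContDiff ℝ 1 f := by
  rw [contDiff_one_iff_fderiv]
  refine ⟨fun x => (hf x).differentiableAt, ?_⟩
  have : fderiv ℝ f = fun x => InnerProductSpace.toDual ℝ H (g x) :=
    funext fun x => (hf x).hasFDerivAt.fderiv
  rw [this]
  exact (InnerProductSpace.toDual ℝ H).continuous.comp hg

/-- Under constant rank, a vector orthogonal to the gradients of the `f i`, `i ∈ J`, is the velocity of
a curve on which all of these functions are constant. This part of the constant rank theorem needs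
only the finite-dimensional implicit function theorem. -/
theorem exists_curve_hasDerivAt_of_finrank_eq {f : ι → H → ℝ} {g : ι → H → H}
    (hf : ∀ i x, HasGradientAt (f i) (g i x) x) (hg : ∀ i, Continuous (g i)) (J : Finset ι) (y : H)
    (hrank : ∀ᶠ x in 𝓝 y, Module.finrank ℝ (Submodule.span ℝ ((fun i => g i x) '' J)) =
      Module.finrank ℝ (Submodule.span ℝ ((fun i => g i y) '' J)))
    {d : H} (hd : ∀ i ∈ J, inner ℝ (g i y) d = 0) :
    ∃ c : ℝ → H, c 0 = y ∧ HasDerivAt c d 0 ∧ ∀ᶠ t in 𝓝 (0 : ℝ), ∀ i ∈ J, f i (c t) = f i y := by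
  obtain ⟨B, hBJ, hBind, hBspan⟩ := exists_linearIndepOn_span_image_eq (fun i => g i y) J
  have hspan : ∀ᶠ x in 𝓝 y,
      Submodule.span ℝ ((fun i => g i x) '' B) = Submodule.span ℝ ((fun i => g i x) '' J) := by
    obtain ⟨_, -, hB⟩ := hBind.eventually_sum_abs_le fun i _ => (hg i).continuousAt
    filter_upwards [hB, hrank] with x hx hr
    refine span_image_eq_of_finrank_eq_card hBJ (linearIndepOn_of_sum_abs_le hx) ?_
    rw [hr, ← hBspan, linearIndepOn_iff_finrank_span_image.1 hBind]
  -- The curve is `c t = y + t d + ∑ b ∈ B, φ t b • g b y`, with the correction `φ` determined by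
  -- the equations `f b (c t) = f b y`, `b ∈ B`.
  let A : ℝ × (B → ℝ) →L[ℝ] H := (ContinuousLinearMap.fst ℝ ℝ (B → ℝ)).smulRight d +
    ∑ b : B, ((ContinuousLinearMap.proj b).comp
      (ContinuousLinearMap.snd ℝ ℝ (B → ℝ))).smulRight (g b y)
  have hA : ∀ t z, A (t, z) = t • d + ∑ b : B, z b • g b y := fun t z => by simp [A]
  let Φ : ℝ × (B → ℝ) → (B → ℝ) := fun q b => f b (y + A q)
  have hΦ : ContDiff ℝ 1 Φ := contDiff_pi.2 fun b =>
    (contDiff_one_of_hasGradientAt (hf b) (hg b)).comp (contDiff_const.add A.contDiff)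
  have hΦat : ContDiffAt ℝ 1 Φ (0, 0) := hΦ.contDiffAt
  have hΦ' : fderiv ℝ Φ (0, 0) = ContinuousLinearMap.pi fun b : B =>
      (InnerProductSpace.toDual ℝ H (g b y)).comp A := by
    refine HasFDerivAt.fderiv (hasFDerivAt_pi.2 fun b => ?_)
    have h1 : HasFDerivAt (fun q => y + A q) A ((0, 0) : ℝ × (B → ℝ)) :=
      A.hasFDerivAt.const_add y
    refine HasFDerivAt.comp _ ?_ h1
    simpa [hA] using (hf b y).hasFDerivAt
  have hinv : (fderiv ℝ Φ (0, 0) ∘L .inr ℝ ℝ (B → ℝ)).IsInvertible := by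
    set N := fderiv ℝ Φ (0, 0) ∘L .inr ℝ ℝ (B → ℝ) with hN
    -- `N` is the Gram matrix of the independent family `g b y`, `b ∈ B`.
    have hinj : Function.Injective (N : (B → ℝ) →ₗ[ℝ] (B → ℝ)) := by
      rw [← LinearMap.ker_eq_bot, LinearMap.ker_eq_bot']
      intro z hz
      have h1 : ∀ b : B, inner ℝ (g b y) (∑ b : B, z b • g b y) = 0 := fun b => by
        have := congrFun hz b
        simpa [hN, hΦ', hA, inner_sum, inner_smul_right] using this
      have h2 : ∑ b : B, z b • g b y = 0 := by
        rw [← inner_self_eq_zero (𝕜 := ℝ)]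
        nth_rewrite 1 [sum_inner]
        exact Finset.sum_eq_zero fun b _ => by rw [inner_smul_left, h1, mul_zero]
      ext b
      exact Fintype.linearIndependent_iff.1 hBind z h2 b
    refine ⟨(LinearEquiv.ofInjectiveEndo _ hinj).toContinuousLinearEquiv, ?_⟩
    ext z : 1
    rfl
  set φ := hΦat.implicitFunction one_ne_zero hinv
  have hφ0 : φ 0 = 0 := hΦat.implicitFunction_apply_self one_ne_zero hinv
  have hφcd : ContDiffAt ℝ 1 φ 0 := hΦat.contDiffAt_implicitFunction one_ne_zero hinv
  have hφd : HasDerivAt φ 0 0 := by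
    have h1 := (hΦat.hasStrictFDerivAt_implicitFunction one_ne_zero hinv).hasFDerivAt.hasDerivAt
    have h2 : (fderiv ℝ Φ (0, 0) ∘L .inl ℝ ℝ (B → ℝ)) = 0 := by
      ext b
      simp [hΦ', hA, hd b (hBJ b.2)]
    rw [h2] at h1
    simpa using h1
  have hφev : ∀ᶠ t in 𝓝 (0 : ℝ), Φ (t, φ t) = Φ (0, 0) :=
    hΦat.eventually_apply_implicitFunction one_ne_zero hinv
  let c : ℝ → H := fun t => y + A (t, φ t)
  have hc0 : c 0 = y := by simp [c, hφ0, hA]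
  have hcd : ∀ t, DifferentiableAt ℝ φ t → DifferentiableAt ℝ c t := fun t ht => by
    fun_prop
  have hc' : HasDerivAt c d 0 := by
    have h1 : HasDerivAt (fun t => (t, φ t)) ((1 : ℝ), (0 : B → ℝ)) 0 :=
      (hasDerivAt_id 0).prodMk hφd
    have h2 := (A.hasFDerivAt.comp_hasDerivAt 0 h1).const_add y
    have h3 : A ((1 : ℝ), (0 : B → ℝ)) = d := by simp [hA]
    rwa [h3] at h2
  have hφdiff : ∀ᶠ t in 𝓝 (0 : ℝ), DifferentiableAt ℝ φ t :=
    (hφcd.eventually (by simp)).mono fun t ht => ht.differentiableAt one_ne_zero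
  have hspanc : ∀ᶠ t in 𝓝 (0 : ℝ), Submodule.span ℝ ((fun i => g i (c t)) '' B) =
      Submodule.span ℝ ((fun i => g i (c t)) '' J) := by
    have h1 : Filter.Tendsto c (𝓝 0) (𝓝 y) := by simpa only [hc0] using hc'.continuousAt.tendsto
    exact h1.eventually hspan
  refine ⟨c, hc0, hc', ?_⟩
  have hall := (hφev.eventually_nhds.and (hφdiff.and hspanc))
  obtain ⟨δ, hδ, hball⟩ := Metric.eventually_nhds_iff_ball.1 hall
  filter_upwards [Metric.ball_mem_nhds (0 : ℝ) hδ] with t ht i hi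
  have hder : ∀ j, ∀ s ∈ Metric.ball (0 : ℝ) δ,
      HasDerivAt (fun r => f j (c r)) (inner ℝ (g j (c s)) (deriv c s)) s := by
    intro j s hs
    have h1 := (hcd s (hball s hs).2.1).hasDerivAt
    exact (hf j (c s)).hasFDerivAt.comp_hasDerivAt s h1
  -- The velocity is orthogonal to the gradients in `B`, hence to their span, which contains those
  -- in `J`.
  have hzero : ∀ j ∈ J, ∀ s ∈ Metric.ball (0 : ℝ) δ, inner ℝ (g j (c s)) (deriv c s) = 0 := by
    intro j hj s hs
    have hB : ∀ b ∈ B, inner ℝ (g b (c s)) (deriv c s) = 0 := by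
      intro b hb
      refine (hder b s hs).unique ?_
      refine (hasDerivAt_const s (f b y)).congr_of_eventuallyEq ?_
      filter_upwards [(hball s hs).1] with r hr
      have := congrFun hr ⟨b, hb⟩
      have h0 : A ((0 : ℝ), (0 : B → ℝ)) = 0 := map_zero A
      simpa only [Φ, h0, add_zero] using this
    have hmem : g j (c s) ∈ Submodule.span ℝ ((fun i => g i (c s)) '' B) := by
      rw [(hball s hs).2.2]
      exact Submodule.subset_span ⟨j, hj, rfl⟩
    generalize g j (c s) = w at hmem
    induction hmem using Submodule.span_induction with
    | mem x hx => obtain ⟨b, hb, rfl⟩ := hx; exact hB b hb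
    | zero => simp
    | add x x' _ _ h1 h2 => rw [inner_add_left, h1, h2, add_zero]
    | smul a x _ h1 => rw [inner_smul_left, h1, mul_zero]
  have := Metric.isOpen_ball.is_const_of_deriv_eq_zero (convex_ball (0 : ℝ) δ).isPreconnected
    (f := fun r => f i (c r))
    (fun s hs => (hder i s hs).differentiableAt.differentiableWithinAt)
    (fun s hs => by rw [(hder i s hs).deriv, hzero i hi s hs]; rfl)
    ht (Metric.mem_ball_self hδ)
  simpa [hc0] using this

end Curve

/-! ### Approximate multipliers -/

/-- The generators without sign constraint matter only through their span. -/
theorem span_image_le_multiplierCone {ι H : Type*} [DecidableEq ι] [AddCommGroup H] [Module ℝ H]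
    {g : ι → H} {E B A : Finset ι} (hEA : Disjoint E A) (hBA : Disjoint B A)
    (hspan : Submodule.span ℝ (g '' E) ≤ Submodule.span ℝ (g '' B)) {v : H}
    (hv : v ∈ multiplierCone g (E ∪ A) A) : v ∈ multiplierCone g (B ∪ A) A := by
  obtain ⟨μ, hμ, rfl⟩ := hv
  have hmem : ∑ i ∈ E, μ i • g i ∈ Submodule.span ℝ (g '' B) :=
    hspan (Submodule.sum_mem _ fun i hi =>
      Submodule.smul_mem _ _ (Submodule.subset_span ⟨i, hi, rfl⟩))
  obtain ⟨ν, hν⟩ := (Submodule.mem_span_image_finset_iff_exists_fun ℝ).1 hmem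
  refine ⟨fun i => if hi : i ∈ B then ν ⟨i, hi⟩ else μ i, fun i hi => ?_, ?_⟩
  · simpa [Finset.disjoint_right.1 hBA hi] using hμ i hi
  rw [Finset.sum_union hEA, Finset.sum_union hBA, ← hν]
  congr 1
  · rw [← Finset.sum_coe_sort B]
    exact Finset.sum_congr rfl fun i _ => by simp
  · exact Finset.sum_congr rfl fun i hi => by simp [Finset.disjoint_right.1 hBA hi]

section Multiplier

variable {ι H : Type*} [DecidableEq ι] [NormedAddCommGroup H] [InnerProductSpace ℝ H]
  [CompleteSpace H]

/-- First-order conditions at an approximate projection `y` of `x` onto the set of `z` with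
`f i z ≤ 0` for `i ∈ I` and `f i z = 0` for `i ∈ E`, under constancy of rank: the direction from `y`
to `x` is almost a combination of gradients of active constraints with admissible signs. The
set `A` contains the active indices of `I`, and only indices of functions vanishing at `y`. -/
theorem exists_multiplier_of_le_norm_add {f : ι → H → ℝ} {g : ι → H → H}
    (hf : ∀ i x, HasGradientAt (f i) (g i x) x) (hg : ∀ i, Continuous (g i)) {I E A : Finset ι}
    {x y : H} (hEA : Disjoint E A) (hA : ∀ i ∈ I, i ∈ A ∨ f i y < 0)
    (hA0 : ∀ i ∈ A, f i y = 0) (hE0 : ∀ i ∈ E, f i y = 0)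
    (hrank : ∀ K ⊆ A, ∀ᶠ z in 𝓝 y,
      Module.finrank ℝ (Submodule.span ℝ ((fun i => g i z) '' (E ∪ K : Finset ι))) =
      Module.finrank ℝ (Submodule.span ℝ ((fun i => g i y) '' (E ∪ K : Finset ι))))
    {ε : ℝ} (hε : 0 < ε) (hxy : x ≠ y)
    (hmin : ∀ z, (∀ i ∈ I, f i z ≤ 0) → (∀ i ∈ E, f i z = 0) → ‖x - y‖ ≤ ‖x - z‖ + ε * ‖y - z‖) :
    ∃ v ∈ multiplierCone (fun i => g i y) (E ∪ A) A, ‖‖x - y‖⁻¹ • (x - y) - v‖ ≤ 2 * ε := by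
  have hpos : 0 < ‖x - y‖ := norm_pos_iff.2 (sub_ne_zero.2 hxy)
  refine PointedCone.exists_norm_sub_le_of_inner_le _ hε fun w hw => ?_
  have hwA : ∀ i ∈ A, inner ℝ (g i y) w ≤ 0 := fun i hi => by
    refine hw _ ⟨Pi.single i 1, fun j _ => ?_, ?_⟩
    · by_cases hji : j = i
      · subst hji; simp
      · simp [hji]
    · rw [Finset.sum_eq_single_of_mem i (Finset.mem_union_right _ hi)
        (fun j _ hji => by simp [hji])]
      simp
  have hwE : ∀ i ∈ E, inner ℝ (g i y) w = 0 := fun i hi => by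
    have hs : ∀ s : ℝ, inner ℝ (s • g i y) w ≤ 0 := fun s => by
      refine hw _ ⟨Pi.single i s, fun j hj => ?_, ?_⟩
      · have hji : j ≠ i := fun h => Finset.disjoint_left.1 hEA hi (h ▸ hj)
        simp [hji]
      · rw [Finset.sum_eq_single_of_mem i (Finset.mem_union_left _ hi)
          (fun j _ hji => by simp [hji])]
        simp
    have h1 := hs 1
    have h2 := hs (-1)
    simp only [one_smul, neg_smul, inner_neg_left] at h1 h2
    linarith
  -- `w` lies in the linearised cone. The curve keeps the constraints in `E ∪ K` at zero, and those
  -- in `A \ K` decrease strictly to first order.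
  set K := A.filter fun i => inner ℝ (g i y) w = 0 with hK
  have hKA : K ⊆ A := Finset.filter_subset _ _
  obtain ⟨c, hc0, hc', hcEK⟩ := exists_curve_hasDerivAt_of_finrank_eq hf hg (E ∪ K) y
    (hrank K hKA) (d := w) (fun i hi => by
      rcases Finset.mem_union.1 hi with h | h
      · exact hwE i h
      · exact (Finset.mem_filter.1 h).2)
  have hct : Filter.Tendsto c (𝓝[>] 0) (𝓝 y) := by
    rw [← hc0]
    exact hc'.continuousAt.tendsto.mono_left nhdsWithin_le_nhds
  have hslope : Filter.Tendsto (fun t : ℝ => t⁻¹ • (c t - y)) (𝓝[>] 0) (𝓝 w) := by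
    have := hc'.tendsto_slope_zero_right
    simpa [hc0] using this
  have hcI : ∀ᶠ t in 𝓝[>] (0 : ℝ), ∀ i ∈ I, f i (c t) ≤ 0 := by
    rw [Filter.eventually_all_finset]
    intro i hi
    rcases hA i hi with hiA | hneg
    · by_cases hiK : inner ℝ (g i y) w = 0
      · filter_upwards [hcEK.filter_mono nhdsWithin_le_nhds] with t ht
        rw [ht i (Finset.mem_union_right _ (Finset.mem_filter.2 ⟨hiA, hiK⟩)), hA0 i hiA]
      · have hlt : inner ℝ (g i y) w < 0 := lt_of_le_of_ne (hwA i hiA) hiK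
        have hd : HasDerivAt (f i ∘ c) (inner ℝ (g i y) w) 0 := by
          have h1 := (hf i (c 0)).hasFDerivAt.comp_hasDerivAt 0 hc'
          simpa [hc0] using h1
        have h2 := hd.tendsto_slope_zero_right.eventually (gt_mem_nhds hlt)
        filter_upwards [h2, self_mem_nhdsWithin] with t ht ht0
        simp only [zero_add, Function.comp_apply, hc0, hA0 i hiA, sub_zero, smul_eq_mul] at ht
        have ht0' : (0 : ℝ) < t := ht0
        by_contra! hcon
        exact absurd ht (not_lt.2 (by positivity))
    · have h1 : Filter.Tendsto (fun t => f i (c t)) (𝓝[>] 0) (𝓝 (f i y)) :=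
        ((hf i y).hasFDerivAt.continuousAt.tendsto).comp hct
      exact (h1.eventually (gt_mem_nhds hneg)).mono fun t ht => ht.le
  have hcE : ∀ᶠ t in 𝓝[>] (0 : ℝ), ∀ i ∈ E, f i (c t) = 0 := by
    filter_upwards [hcEK.filter_mono nhdsWithin_le_nhds] with t ht i hi
    rw [ht i (Finset.mem_union_left _ hi), hE0 i hi]
  -- Moving `t > 0` along the curve shortens the distance to `x` by at most `ε * ‖y - c t‖`; the
  -- Cauchy–Schwarz inequality avoids differentiating the norm.
  have hlim : inner ℝ (x - y) w ≤ ε * ‖w‖ * ‖x - y‖ := by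
    have h1 : Filter.Tendsto (fun t : ℝ => inner ℝ (x - c t) (t⁻¹ • (c t - y))) (𝓝[>] 0)
        (𝓝 (inner ℝ (x - y) w)) := (tendsto_const_nhds.sub hct).inner hslope
    have h2 : Filter.Tendsto (fun t : ℝ => ε * ‖t⁻¹ • (c t - y)‖ * ‖x - c t‖) (𝓝[>] 0)
        (𝓝 (ε * ‖w‖ * ‖x - y‖)) :=
      (tendsto_const_nhds.mul hslope.norm).mul (tendsto_const_nhds.sub hct).norm
    refine le_of_tendsto_of_tendsto h1 h2 ?_
    filter_upwards [hcI, hcE, self_mem_nhdsWithin] with t htI htE ht0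
    have ht0' : (0 : ℝ) < t := ht0
    have h3 := hmin (c t) htI htE
    have h4 := real_inner_le_norm (x - c t) (x - y)
    have h5 : inner ℝ (x - c t) (x - y) = ‖x - c t‖ * ‖x - c t‖ + inner ℝ (x - c t) (c t - y) := by
      rw [← real_inner_self_eq_norm_mul_norm, ← inner_add_right, sub_add_sub_cancel]
    have h6 := mul_le_mul_of_nonneg_left h3 (norm_nonneg (x - c t))
    rw [norm_sub_rev y] at h6
    have h7 : inner ℝ (x - c t) (c t - y) ≤ ε * ‖c t - y‖ * ‖x - c t‖ := by linarith
    rw [inner_smul_right, norm_smul, Real.norm_of_nonneg (inv_nonneg.2 ht0'.le)]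
    calc t⁻¹ * inner ℝ (x - c t) (c t - y) ≤ t⁻¹ * (ε * ‖c t - y‖ * ‖x - c t‖) :=
          mul_le_mul_of_nonneg_left h7 (inv_nonneg.2 ht0'.le)
      _ = _ := by ring
  rw [real_inner_smul_left, inv_mul_le_iff₀ hpos]
  linarith

end Multiplier

/-! ### Uniform estimates near the reference point -/

/-- Joint continuity of the gradient makes the first-order expansion in `x` uniform in the
parameter. -/
theorem eventually_abs_sub_sub_inner_le {G H : Type*} [TopologicalSpace G]
    [NormedAddCommGroup H] [InnerProductSpace ℝ H] [CompleteSpace H] {f : G → H → ℝ}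
    {g : G → H → H} (hf : ∀ p x, HasGradientAt (f p) (g p x) x)
    {p₀ : G} {x₀ : H} (hg : ContinuousAt (fun z : G × H => g z.1 z.2) (p₀, x₀))
    {η : ℝ} (hη : 0 < η) :
    ∀ᶠ q : G × H × H in 𝓝 (p₀, x₀, x₀),
      |f q.1 q.2.1 - f q.1 q.2.2 - inner ℝ (g q.1 q.2.2) (q.2.1 - q.2.2)|
        ≤ η * ‖q.2.1 - q.2.2‖ := by
  have h1 := hg.eventually (Metric.ball_mem_nhds (g p₀ x₀) (half_pos hη))
  rw [nhds_prod_eq] at h1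
  obtain ⟨P, hP, Q, hQ, hPQ⟩ := Filter.eventually_prod_iff.1 h1
  obtain ⟨r, hr, hball⟩ := Metric.eventually_nhds_iff_ball.1 hQ
  have h2 : ∀ᶠ x in 𝓝 x₀, x ∈ Metric.ball x₀ r := Metric.ball_mem_nhds x₀ hr
  rw [nhds_prod_eq, nhds_prod_eq]
  filter_upwards [hP.prod_mk (h2.prod_mk h2)]
  rintro ⟨p, x, y⟩ ⟨hp, hx, hy⟩
  have hclose : ∀ z ∈ Metric.ball x₀ r, dist (g p z) (g p₀ x₀) < η / 2 :=
    fun z hz => hPQ hp (hball z hz)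
  have := (convex_ball x₀ r).norm_image_sub_le_of_norm_hasFDerivWithin_le'
    (f := f p) (φ := InnerProductSpace.toDual ℝ H (g p y)) (C := η)
    (fun z _ => (hf p z).hasFDerivAt.hasFDerivWithinAt) (fun z hz => by
      rw [← map_sub, LinearIsometryEquiv.norm_map, ← dist_eq_norm]
      have := dist_triangle_right (g p z) (g p y) (g p₀ x₀)
      linarith [hclose z hz, hclose y hy]) hy hx
  simpa using this

theorem eventually_uniform_multiplier_bound {ι H Z : Type*} [NormedAddCommGroup H]
    [NormedSpace ℝ H] [TopologicalSpace Z] {g : ι → Z → H} {z₀ : Z}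
    (hg : ∀ i, ContinuousAt (g i) z₀) (𝒮 : Finset (Finset ι)) :
    ∃ c : ℝ, 0 < c ∧ ∀ᶠ z in 𝓝 z₀, ∀ S ∈ 𝒮, LinearIndepOn ℝ (fun i => g i z₀) (S : Set ι) →
      ∀ μ : ι → ℝ, ∑ i ∈ S, |μ i| ≤ c * ‖∑ i ∈ S, μ i • g i z‖ := by
  classical
  induction 𝒮 using Finset.induction_on with
  | empty => exact ⟨1, one_pos, by simp⟩
  | insert S 𝒮 _ ih =>
    obtain ⟨c, hc, hev⟩ := ih
    by_cases hS : LinearIndepOn ℝ (fun i => g i z₀) (S : Set ι)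
    · obtain ⟨c', hc', hev'⟩ := hS.eventually_sum_abs_le fun i _ => hg i
      refine ⟨max c c', lt_max_of_lt_left hc, ?_⟩
      filter_upwards [hev, hev'] with z h1 h2 T hT hTi μ
      rcases Finset.mem_insert.1 hT with rfl | hT
      · exact (h2 μ).trans (mul_le_mul_of_nonneg_right (le_max_right _ _) (norm_nonneg _))
      · exact (h1 T hT hTi μ).trans
          (mul_le_mul_of_nonneg_right (le_max_left _ _) (norm_nonneg _))
    · refine ⟨c, hc, ?_⟩
      filter_upwards [hev] with z h1 T hT hTi μ
      rcases Finset.mem_insert.1 hT with rfl | hT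
      · exact absurd hTi hS
      · exact h1 T hT hTi μ

/-! ### The constraint residual -/

section Residual

variable {G H : Type*} {m n : ℕ} {h : Fin n → G → H → ℝ} {p : G} {x : H}

theorem constraintResidual_nonneg : 0 ≤ constraintResidual m h p x := le_max_left _ _

theorem le_constraintResidual {i : Fin n} (hi : i ∈ ineqIdx m n) :
    h i p x ≤ constraintResidual m h p x :=
  ((le_ciSup (f := fun i : ineqIdx m n => h i p x) (Set.finite_range _).bddAbove
    ⟨i, hi⟩).trans (le_max_left _ _)).trans (le_max_right _ _)

theorem abs_le_constraintResidual {i : Fin n} (hi : i ∈ eqIdx m n) :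
    |h i p x| ≤ constraintResidual m h p x :=
  ((le_ciSup (f := fun i : eqIdx m n => |h i p x|) (Set.finite_range _).bddAbove
    ⟨i, hi⟩).trans (le_max_right _ _)).trans (le_max_right _ _)

end Residual

/-- The sign condition on the multiplier matches the one-sided control of an inequality constraint by
the residual. -/
theorem mul_inner_le_of_feasible {m n : ℕ} {G H : Type*} [NormedAddCommGroup H]
    [InnerProductSpace ℝ H] {h : Fin n → G → H → ℝ} {p : G} {x y w : H} {η : ℝ} {i : Fin n}
    {μ : ℝ} (hμ : i ∈ eqIdx m n ∨ (i ∈ ineqIdx m n ∧ 0 ≤ μ)) (hy : h i p y = 0)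
    (hw : |h i p x - h i p y - inner ℝ w (x - y)| ≤ η * ‖x - y‖) :
    μ * inner ℝ w (x - y) ≤ |μ| * (constraintResidual m h p x + η * ‖x - y‖) := by
  rw [hy, sub_zero, abs_le] at hw
  rcases hμ with hi | ⟨hi, hμ⟩
  · have h1 := abs_le.1 (abs_le_constraintResidual (m := m) (h := h) (p := p) (x := x) hi)
    refine (le_abs_self _).trans ?_
    rw [abs_mul]
    refine mul_le_mul_of_nonneg_left (abs_le.2 ⟨?_, ?_⟩) (abs_nonneg _) <;> linarith
  · have h1 := le_constraintResidual (m := m) (h := h) (p := p) (x := x) hi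
    rw [abs_of_nonneg hμ]
    exact mul_le_mul_of_nonneg_left (by linarith) hμ

/-! ### R-regularity of the feasible set mapping -/

theorem mainTheorem2 {G H : Type*} [NormedAddCommGroup G] [NormedSpace ℝ G]
    [NormedAddCommGroup H] [InnerProductSpace ℝ H] [CompleteSpace H]
    (m n : ℕ) (hmn : m ≤ n) (h : Fin n → G → H → ℝ)
    (h_cont : ∀ i, Continuous (fun z : G × H => h i z.1 z.2))
    (h_diff : ∀ i p, Differentiable ℝ (h i p))
    (h_grad : ∀ i, Continuous (fun z : G × H => gradient (h i z.1) z.2))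
    (p₀ : G) (x₀ : H) (h_mem : (p₀, x₀) ∈ setValuedGraph (feasibleMap m h))
    (h_lsc : LscAtRel (feasibleMap m h) (setValuedDom (feasibleMap m h)) p₀ x₀)
    (h_rcrcq : RCRCQ m h (setValuedDom (feasibleMap m h)) Set.univ p₀ x₀) :
    RRegular m h (setValuedDom (feasibleMap m h)) p₀ x₀ := by
  classical
  let g : Fin n → G × H → H := fun i z => gradient (h i z.1) z.2
  have hg : ∀ i, Continuous (g i) := h_grad
  have hgr : ∀ i p x, HasGradientAt (h i p) (g i (p, x)) x := fun i p x =>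
    (h_diff i p x).hasGradientAt
  let I : Finset (Fin n) := Finset.univ.filter fun i => i ∈ ineqIdx m n
  let E : Finset (Fin n) := Finset.univ.filter fun i => i ∈ eqIdx m n
  let A₀ : Finset (Fin n) := Finset.univ.filter fun i => i ∈ activeIdx m h p₀ x₀
  have hI : ∀ i, i ∈ I ↔ i ∈ ineqIdx m n := fun i => Finset.mem_filter_univ i
  have hE : ∀ i, i ∈ E ↔ i ∈ eqIdx m n := fun i => Finset.mem_filter_univ i
  have hA₀ : ∀ i, i ∈ A₀ ↔ i ∈ ineqIdx m n ∧ h i p₀ x₀ = 0 := fun i => Finset.mem_filter_univ i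
  have hIE : Disjoint E I := by
    rw [Finset.disjoint_left]
    intro i hiE hiI
    have h1 : m ≤ (i : ℕ) := (hE i).1 hiE
    have h2 : (i : ℕ) < m := (hI i).1 hiI
    omega
  -- The rank condition is used only for subsets of the finite set `A₀`, on one common neighbourhood.
  let rk : Finset (Fin n) → G × H → ℕ := fun K z =>
    Module.finrank ℝ (Submodule.span ℝ ((fun i => g i z) '' (E ∪ K : Finset (Fin n))))
  have hrank : ∀ᶠ z in 𝓝 (p₀, x₀), z.1 ∈ setValuedDom (feasibleMap m h) →
      ∀ K ∈ A₀.powerset, rk K z = rk K (p₀, x₀) := by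
    have : ∀ᶠ z in 𝓝 (p₀, x₀), ∀ K ∈ A₀.powerset,
        z.1 ∈ setValuedDom (feasibleMap m h) → rk K z = rk K (p₀, x₀) := by
      rw [Filter.eventually_all_finset]
      intro K hK
      obtain ⟨U, hU, hUrank⟩ := h_rcrcq (K : Set (Fin n)) fun i hi =>
        (hA₀ i).1 (Finset.mem_powerset.1 hK hi)
      have hcoe : ((E ∪ K : Finset (Fin n)) : Set (Fin n)) = eqIdx m n ∪ K := by
        ext i
        simp [hE]
      filter_upwards [hU] with z hz hzd
      have := hUrank z ⟨hz, hzd, trivial⟩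
      simp only [rk]
      rw [hcoe]
      exact this
    exact this.mono fun z hz hzd K hK => hz K hK hzd
  have hneg : ∀ᶠ z in 𝓝 (p₀, x₀), ∀ i ∈ I \ A₀, h i z.1 z.2 < 0 := by
    rw [Filter.eventually_all_finset]
    intro i hi
    refine (h_cont i).continuousAt.eventually (gt_mem_nhds ?_)
    rw [Finset.mem_sdiff, hI, hA₀] at hi
    exact lt_of_le_of_ne (h_mem.1 i hi.1) fun h0 => hi.2 ⟨hi.1, h0⟩
  obtain ⟨B, hBE, hBind, hBspan⟩ := exists_linearIndepOn_span_image_eq (fun i => g i (p₀, x₀)) E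
  obtain ⟨c, hc, hbound⟩ := eventually_uniform_multiplier_bound (z₀ := (p₀, x₀))
    (fun i => (hg i).continuousAt) (A₀.powerset.image fun K => B ∪ K)
  -- With `ε = 1/8` the multipliers satisfy `∑ |μ i| ≤ 5c/4`, and the linearisation error
  -- `1 / (5c)` then contributes `‖x - y‖ / 4`; the approximation `‖u - v‖ ≤ 1/4` contributes as much.
  have hη : 0 < 1 / (5 * c) := by positivity
  have hmean : ∀ᶠ q : G × H × H in 𝓝 (p₀, x₀, x₀), ∀ i,
      |h i q.1 q.2.1 - h i q.1 q.2.2 - inner ℝ (g i (q.1, q.2.2)) (q.2.1 - q.2.2)|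
        ≤ 1 / (5 * c) * ‖q.2.1 - q.2.2‖ :=
    Filter.eventually_all.2 fun i => eventually_abs_sub_sub_inner_le (g := fun p x => g i (p, x))
      (hgr i) (hg i).continuousAt hη
  obtain ⟨r₁, hr₁, hball₁⟩ := Metric.eventually_nhds_iff_ball.1 (hrank.and (hneg.and hbound))
  obtain ⟨r₂, hr₂, hball₂⟩ := Metric.eventually_nhds_iff_ball.1 hmean
  set r := min r₁ r₂
  have hr0 : 0 < r := lt_min hr₁ hr₂
  have hloc : ∀ p ∈ Metric.ball p₀ r, ∀ y ∈ Metric.ball x₀ r, (p, y) ∈ Metric.ball (p₀, x₀) r₁ :=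
    fun p hp y hy => by
      rw [← ball_prod_same]
      exact ⟨Metric.ball_subset_ball (min_le_left _ _) hp,
        Metric.ball_subset_ball (min_le_left _ _) hy⟩
  -- The radius `r / 4` ensures `‖x - y‖ ≤ ‖x - y₀‖ < r / 2`, so that `y` stays in the ball of radius `r`.
  obtain ⟨V, hV, hVlsc⟩ := h_lsc _ (Metric.ball_mem_nhds x₀ (ε := r / 4) (by positivity))
  refine ⟨5 / 2 * c, by positivity, V ∩ Metric.ball p₀ r,
    Filter.inter_mem hV (Metric.ball_mem_nhds p₀ hr0), Metric.ball x₀ (r / 4),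
    Metric.ball_mem_nhds x₀ (by positivity), ?_⟩
  rintro x hx p ⟨⟨hpV, hpr⟩, hpd⟩
  obtain ⟨y₀, hy₀, hy₀r⟩ := hVlsc p ⟨hpV, hpd⟩
  have hcontx : ∀ i, Continuous (h i p) := fun i => (h_diff i p).continuous
  have hFclosed : IsClosed (feasibleMap m h p) := by
    have : feasibleMap m h p = (⋂ i ∈ ineqIdx m n, {x | h i p x ≤ 0}) ∩
        ⋂ i ∈ eqIdx m n, {x | h i p x = 0} := by
      ext z
      simp [feasibleMap]
    rw [this]
    exact (isClosed_biInter fun i _ => isClosed_le (hcontx i) continuous_const).inter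
      (isClosed_biInter fun i _ => isClosed_eq (hcontx i) continuous_const)
  have := hFclosed.completeSpace_coe
  obtain ⟨⟨y, hyF⟩, hyle, hymin⟩ := exists_forall_le_add_mul_dist
    (f := fun z : feasibleMap m h p => ‖x - z‖) (by fun_prop) (fun _ => norm_nonneg _)
    (ε := 1 / 8) (by norm_num) ⟨y₀, hy₀⟩
  suffices hmain : ‖x - y‖ ≤ 5 / 2 * c * constraintResidual m h p x by
    refine (Metric.infEDist_le_edist_of_mem hyF).trans ?_
    rw [edist_dist, dist_eq_norm]
    exact ENNReal.ofReal_le_ofReal hmain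
  rcases eq_or_ne x y with rfl | hxy
  · rw [sub_self, norm_zero]
    exact mul_nonneg (by positivity) constraintResidual_nonneg
  have hyr : y ∈ Metric.ball x₀ r := by
    have h1 := dist_triangle y x x₀
    have h2 := dist_triangle_right x y₀ x₀
    simp only [← dist_eq_norm] at hyle
    rw [Metric.mem_ball] at hx hy₀r ⊢
    rw [dist_comm y x] at h1
    linarith
  have hxr : x ∈ Metric.ball x₀ r := Metric.ball_subset_ball (by linarith) hx
  obtain ⟨hrk, hng, hbd⟩ := hball₁ _ (hloc p hpr y hyr)
  have hmv : ∀ i, |h i p x - h i p y - inner ℝ (g i (p, y)) (x - y)|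
      ≤ 1 / (5 * c) * ‖x - y‖ := by
    refine hball₂ (p, x, y) ?_
    rw [← ball_prod_same, ← ball_prod_same]
    exact ⟨Metric.ball_subset_ball (min_le_right _ _) hpr,
      Metric.ball_subset_ball (min_le_right _ _) hxr,
      Metric.ball_subset_ball (min_le_right _ _) hyr⟩
  -- Constraints inactive at the reference point are inactive at `(p, y)`, so the active set `A` at
  -- `(p, y)` is covered by the rank condition.
  let A : Finset (Fin n) := I.filter fun i => h i p y = 0
  have hAI : A ⊆ I := Finset.filter_subset _ _
  have hAA₀ : A ⊆ A₀ := fun i hi => by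
    by_contra hcon
    exact (hng i (Finset.mem_sdiff.2 ⟨hAI hi, hcon⟩)).ne (Finset.mem_filter.1 hi).2
  have hEA : Disjoint E A := hIE.mono_right hAI
  have hBA : Disjoint B A := hEA.mono_left hBE
  have hE0 : ∀ i ∈ E, h i p y = 0 := fun i hi => hyF.2 i ((hE i).1 hi)
  obtain ⟨v, hv, huv⟩ := exists_multiplier_of_le_norm_add (f := fun i => h i p)
    (g := fun i y => g i (p, y)) (I := I) (E := E) (A := A) (x := x) (y := y) (ε := 1 / 8)
    (fun i => hgr i p) (fun i => (hg i).comp (by fun_prop)) hEA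
    (fun i hi => by
      rcases (hyF.1 i ((hI i).1 hi)).eq_or_lt with h0 | h0
      · exact Or.inl (Finset.mem_filter.2 ⟨hi, h0⟩)
      · exact Or.inr h0)
    (fun i hi => (Finset.mem_filter.1 hi).2) hE0
    (fun K hK => by
      have hK' : K ∈ A₀.powerset := Finset.mem_powerset.2 (hK.trans hAA₀)
      filter_upwards [Metric.isOpen_ball.mem_nhds hyr] with z hz
      exact ((hball₁ _ (hloc p hpr z hz)).1 hpd K hK').trans (hrk hpd K hK').symm)
    (by norm_num) hxy
    (fun z hzI hzE => by
      rw [← dist_eq_norm y z]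
      exact hymin ⟨z, fun i hi => hzI i ((hI i).2 hi), fun i hi => hzE i ((hE i).2 hi)⟩)
  have hBi : LinearIndepOn ℝ (fun i => g i (p, y)) (B : Set (Fin n)) :=
    linearIndepOn_of_sum_abs_le (hbd B (Finset.mem_image.2 ⟨∅, by simp, by simp⟩) hBind)
  have hBspan' : Submodule.span ℝ ((fun i => g i (p, y)) '' B) =
      Submodule.span ℝ ((fun i => g i (p, y)) '' E) := by
    refine span_image_eq_of_finrank_eq_card hBE hBi ?_
    have h1 := hrk hpd ∅ (by simp)
    simp only [rk] at h1
    rw [Finset.union_empty] at h1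
    rw [h1, ← hBspan, linearIndepOn_iff_finrank_span_image.1 hBind]
  obtain ⟨K, hKA, hKind, μ, hμ, hμv⟩ := exists_linearIndepOn_multiplierCone hBA hBi
    (span_image_le_multiplierCone hEA hBA hBspan'.ge hv)
  -- Independence of `B ∪ K` is transferred from `(p, y)` to `(p₀, x₀)`: at both points `B ∪ K` spans
  -- the gradients in `E ∪ K`, whose rank is the same.
  have hKind₀ : LinearIndepOn ℝ (fun i => g i (p₀, x₀))
      ((B ∪ K : Finset (Fin n)) : Set (Fin n)) := by
    have hspan : ∀ z, Submodule.span ℝ ((fun i => g i z) '' B) =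
        Submodule.span ℝ ((fun i => g i z) '' E) →
        Submodule.span ℝ ((fun i => g i z) '' (B ∪ K : Finset (Fin n))) =
        Submodule.span ℝ ((fun i => g i z) '' (E ∪ K : Finset (Fin n))) := fun z hz => by
      rw [Finset.coe_union, Finset.coe_union, Set.image_union, Set.image_union,
        Submodule.span_union, Submodule.span_union, hz]
    have h1 : rk K (p, y) = rk K (p₀, x₀) :=
      hrk hpd K (Finset.mem_powerset.2 (hKA.trans hAA₀))
    simp only [rk] at h1
    rw [← hspan _ hBspan, ← hspan _ hBspan', linearIndepOn_iff_finrank_span_image.1 hKind] at h1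
    exact linearIndepOn_iff_finrank_span_image.2 h1.symm
  have hμsum : ∑ i ∈ B ∪ K, |μ i| ≤ c * ‖v‖ := by
    rw [← hμv]
    exact hbd _ (Finset.mem_image.2
      ⟨K, Finset.mem_powerset.2 (hKA.trans hAA₀), rfl⟩) hKind₀ μ
  have hpos : 0 < ‖x - y‖ := norm_pos_iff.2 (sub_ne_zero.2 hxy)
  set u := ‖x - y‖⁻¹ • (x - y) with hu
  have hu1 : ‖u‖ = 1 := by
    rw [hu, norm_smul, norm_inv, norm_norm, inv_mul_cancel₀ hpos.ne']
  have huxy : inner ℝ u (x - y) = ‖x - y‖ := by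
    rw [hu, real_inner_smul_left, real_inner_self_eq_norm_mul_norm, inv_mul_cancel_left₀ hpos.ne']
  have hv1 : ‖v‖ ≤ 5 / 4 := by
    have := norm_sub_norm_le v u
    rw [norm_sub_rev] at this
    linarith
  have hΛ : ∑ i ∈ B ∪ K, |μ i| ≤ 5 / 4 * c :=
    hμsum.trans (by linarith [mul_le_mul_of_nonneg_left hv1 hc.le])
  set R := constraintResidual m h p x
  have hR0 : 0 ≤ R := constraintResidual_nonneg
  have hvxy : inner ℝ v (x - y) ≤ 5 / 4 * c * (R + 1 / (5 * c) * ‖x - y‖) := by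
    rw [← hμv, sum_inner]
    refine le_trans ?_ (mul_le_mul_of_nonneg_right hΛ (by positivity))
    rw [Finset.sum_mul]
    refine Finset.sum_le_sum fun i hi => ?_
    rw [real_inner_smul_left]
    rcases Finset.mem_union.1 hi with hiB | hiK
    · exact mul_inner_le_of_feasible (Or.inl ((hE i).1 (hBE hiB))) (hE0 i (hBE hiB)) (hmv i)
    · exact mul_inner_le_of_feasible (Or.inr ⟨(hI i).1 (hAI (hKA hiK)), hμ i hiK⟩)
        (Finset.mem_filter.1 (hKA hiK)).2 (hmv i)
  have huv' : inner ℝ (u - v) (x - y) ≤ 1 / 4 * ‖x - y‖ :=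
    (real_inner_le_norm _ _).trans (mul_le_mul_of_nonneg_right (by linarith) hpos.le)
  rw [inner_sub_left, huxy] at huv'
  have hcalc : 5 / 4 * c * (R + 1 / (5 * c) * ‖x - y‖) = 5 / 4 * c * R + 1 / 4 * ‖x - y‖ := by
    field_simp
  linarith
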